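/- Let $k\ge 1$ and $N$ be integers and let $v_1,\dots,v_N\in\mathbb{R}^2$ be non-zero vectors such that $\{v_i,v_j\}$ is a basis of $\mathbb{R}^2$ whenever $i\neq j$. For $v=(v^1,v^2)\in\mathbb{R}^2$ and $x=(x^1,x^2)\in\mathbb{R}^k\times\mathbb{R}^k=\mathbb{R}^{2k}$ put $v\cdot x=v^1x^1+v^2x^2\in\mathbb{R}^k$, and for non-negative measurable functions $f_1,\dots,f_N$ on $\mathbb{R}^k$ put $$\Lambda(f_1,\dots,f_N)=\int_{\mathbb{R}^{2k}}\prod_{j=1}^N f_j(v_j\cdot x)\,dx .$$ For $1<p<\infty$, $1\le r\le\infty$ and $\lambda\in\mathbb{R}$ let $\|f\|_{L^{p,r}_\lambda}=\|\,|\cdot|^\lambda f\|_{L^{p,r}(\mathbb{R}^k)}$, where $$\|g\|_{L^{p,r}}=\Big(\int_0^\infty \big(t^{1/p}g^*(t)\big)^r\,\frac{dt}{t}\Big)^{1/r}\ (r<\infty),\qquad \|g\|_{L^{p,\infty}}=\sup_{t>0}t^{1/p}g^*(t),$$ and $g^*(t)=\inf\{\sigma\ge 0: |\{x:|g(x)|>\sigma\}|\le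 t\}$ is the decreasing rearrangement of $g$. **Theorem.** Suppose that $1/p_j\in(0,1)$ and $\lambda_j\in\mathbb{R}$, $j=1,\dots,N$, satisfy $$\sum_{j=1}^N\Big(\frac1{p_j}+\frac{\lambda_j}{k}\Big)=2,\qquad \sum_{j\ne\ell}\Big(\frac1{p_j}+\frac{\lambda_j}{k}\Big)>1\quad\text{and}\quad \sum_{j\neq\ell}\lambda_j\ge 0\qquad(\ell=1,\dots,N),$$ and that $(1/r_1,\dots,1/r_N)\in[0,1]^N$ satisfies $\sum_{j=1}^N 1/r_j\ge 1$. Then there is a finite constant $C$, independent of $f_1,\dots,f_N$, such that for all non-negative measurable functions $f_1,\dots,f_N$ on $\mathbb{R}^k$ $$\Lambda(f_1,\dots,f_N)\le C\prod_{j=1}^N\|f_j\|_{L^{p_j,r_j}_{\lambda_j}} .$$ -/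

import Mathlib

open MeasureTheory
open scoped ENNReal NNReal

noncomputable section

/-- The decreasing rearrangement of a `[0, ∞]`-valued function `f` on a measure space,
`f^*(t) = inf {σ : μ {x : f x > σ} ≤ t}`. -/
def decRearrangement {α : Type*} [MeasurableSpace α] (μ : Measure α) (f : α → ℝ≥0∞)
    (t : ℝ) : ℝ≥0∞ :=
  sInf {σ : ℝ≥0∞ | μ {x | σ < f x} ≤ ENNReal.ofReal t}

/-- The Lorentz quasi-norm `‖f‖_{L^{p,r}}` for `0 < p < ∞` and `0 < r ≤ ∞`:
`(∫_0^∞ (t^{1/p} f^*(t))^r dt/t)^{1/r}` if `r < ∞`, and `sup_{t > 0} t^{1/p} f^*(t)` if `r = ∞`. -/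
def lorentzNorm {α : Type*} [MeasurableSpace α] (μ : Measure α) (p : ℝ) (r : ℝ≥0∞)
    (f : α → ℝ≥0∞) : ℝ≥0∞ :=
  if r = ∞ then
    ⨆ t ∈ Set.Ioi (0 : ℝ), ENNReal.ofReal (t ^ (1 / p)) * decRearrangement μ f t
  else
    (∫⁻ t in Set.Ioi (0 : ℝ),
      (ENNReal.ofReal (t ^ (1 / p)) * decRearrangement μ f t) ^ r.toReal
        * ENNReal.ofReal (1 / t)) ^ (1 / r.toReal)

/-- The weighted Lorentz quasi-norm on `ℝᵏ` with a power weight,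
`‖f‖_{L^{p,r}_lam} = ‖ |·|^lam f ‖_{L^{p,r}}`. -/
def weightedLorentzNorm {k : ℕ} (p : ℝ) (r : ℝ≥0∞) (lam : ℝ)
    (f : EuclideanSpace ℝ (Fin k) → ℝ≥0∞) : ℝ≥0∞ :=
  lorentzNorm volume p r (fun x => ‖x‖ₑ ^ lam * f x)

/-- The multilinear form `Λ(f_1, …, f_N) = ∫_{ℝ^{2k}} ∏_j f_j(v_j · x) dx` for non-negative
functions, where `x = (x¹, x²) ∈ ℝᵏ × ℝᵏ` and `v · x = v¹ x¹ + v² x²`. -/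
def multilinForm {k N : ℕ} (v : Fin N → Fin 2 → ℝ)
    (f : Fin N → EuclideanSpace ℝ (Fin k) → ℝ≥0∞) : ℝ≥0∞ :=
  ∫⁻ x : EuclideanSpace ℝ (Fin k) × EuclideanSpace ℝ (Fin k),
    ∏ j, f j (v j 0 • x.1 + v j 1 • x.2)

end

/-! ### Elementary inequalities -/

/-! Write θ_j = 1/p_j. The core is the restricted estimate `exists_lintegral_prod_indicator_le`: for
f_j = |y|^{-λ_j} 1_{E_j} with |E_j| ≤ M_j, the form is at most C ∏ M_j^{θ_j}. At a given x let
|v_l·x| be the smallest of the norms; by pairwise independence all the others are comparable. The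
weights can therefore be traded for |v_j·x|^{-k s_j} with s_j ≥ 0, provided the total homogeneity is
kept and k s_l ≥ λ_l. The exponents of `exists_nonneg_exponents` also make β_j = θ_j + s_j less than
1 with sum 2, so the product becomes ∏ F_j^{β_j} ≤ ∑_{a≠b} F_a F_b. Each pair integrates to a
constant times ∫F_a ∫F_b by a linear change of variables, and the F_j are normalised to have bounded
integral.

Apart from the scaling identity, the conditions on θ are open. Moving a small ε from one θ_j to
another thus yields geometric decay when the dyadic measures M_j = 2^{n_j+1} differ
(`exists_lintegral_prod_indicator_le_decay`).

For general f_j, |y|^{λ_j} f_j is cut at the dyadic values of its rearrangement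
(`ae_le_tsum_indicator`). The coefficients 2^{nθ_j} D_j(n) lie in ℓ^{r_j}, and the decay together
with ∑ 1/r_j ≥ 1 sums the multiple series (`exists_tsum_prod_le`). -/

theorem ENNReal.prod_rpow_eq_rpow_sum {ι : Type*} (s : Finset ι) (x : ℝ≥0∞) (β : ι → ℝ)
    (h0 : ∀ j ∈ s, 0 ≤ β j) : ∏ j ∈ s, x ^ β j = x ^ ∑ j ∈ s, β j := by
  classical
  induction s using Finset.induction_on with
  | empty => simp
  | insert a s ha ih =>
    rw [Finset.prod_insert ha, Finset.sum_insert ha, ih (fun j hj => h0 j (by simp [hj])),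
      ENNReal.rpow_add_of_nonneg _ _ (h0 a (by simp))
        (Finset.sum_nonneg fun j hj => h0 j (by simp [hj]))]

/-- Let F a be the largest factor and F b the largest of the rest. Replacing the rest by F b leaves
F a ^ β a * F b ^ (2 - β a), and since β a ≤ 1 the surplus power 1 - β a of F b can be passed to F
a. Summing over all pairs removes the dependence of a and b on the point. -/
theorem prod_rpow_le_sum_mul {ι : Type*} [Fintype ι] [DecidableEq ι] (F : ι → ℝ≥0∞) (β : ι → ℝ)
    (h0 : ∀ j, 0 ≤ β j) (h1 : ∀ j, β j ≤ 1) (hs : ∑ j, β j = 2) :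
    ∏ j, F j ^ β j ≤ ∑ a, ∑ b ∈ Finset.univ.erase a, F a * F b := by
  have hne : (Finset.univ : Finset ι).Nonempty := by
    by_contra h
    rw [Finset.not_nonempty_iff_eq_empty] at h
    simp [h] at hs
  obtain ⟨a, -, ha⟩ := Finset.exists_max_image Finset.univ F hne
  have hsa := Finset.add_sum_erase Finset.univ β (Finset.mem_univ a)
  have hne' : (Finset.univ.erase a).Nonempty := by
    by_contra h
    rw [Finset.not_nonempty_iff_eq_empty] at h
    rw [h, Finset.sum_empty] at hsa
    linarith [h1 a]
  obtain ⟨b, hb, hbmax⟩ := Finset.exists_max_image (Finset.univ.erase a) F hne'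
  have hab : F b ≤ F a := ha b (Finset.mem_univ b)
  calc ∏ j, F j ^ β j = F a ^ β a * ∏ j ∈ Finset.univ.erase a, F j ^ β j :=
        (Finset.mul_prod_erase _ _ (Finset.mem_univ a)).symm
    _ ≤ F a ^ β a * ∏ j ∈ Finset.univ.erase a, F b ^ β j := by
        gcongr with j hj
        · exact h0 j
        · exact hbmax j hj
    _ = F a ^ β a * F b ^ ((1 - β a) + 1) := by
        rw [ENNReal.prod_rpow_eq_rpow_sum _ _ _ fun j _ => h0 j]
        congr 2
        linarith
    _ = F a ^ β a * (F b ^ (1 - β a) * F b) := by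
        rw [ENNReal.rpow_add_of_nonneg _ _ (by linarith [h1 a]) zero_le_one, ENNReal.rpow_one]
    _ ≤ F a ^ β a * (F a ^ (1 - β a) * F b) := by
        gcongr
        linarith [h1 a]
    _ = F a * F b := by
        rw [← mul_assoc, ← ENNReal.rpow_add_of_nonneg _ _ (h0 a) (by linarith [h1 a])]
        simp
    _ ≤ ∑ b ∈ Finset.univ.erase a, F a * F b :=
        Finset.single_le_sum (f := fun b => F a * F b) (fun _ _ => zero_le) hb
    _ ≤ _ := Finset.single_le_sum (f := fun a => ∑ b ∈ Finset.univ.erase a, F a * F b)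
        (fun _ _ => zero_le) (Finset.mem_univ a)

/-- If `0 ≤ a j ≤ 1` and `∑ 1 / r j ≥ 1`, then `∏ a j` is at most the sum of the powers
`a j ^ r j` with `r j < ∞`. -/
theorem prod_le_sum_rpow {ι : Type*} [Fintype ι] (a : ι → ℝ≥0∞) (r : ι → ℝ≥0∞)
    (ha : ∀ j, a j ≤ 1) (hr : ∀ j, 1 ≤ r j) (hs : 1 ≤ ∑ j, (r j)⁻¹) :
    ∏ j, a j ≤ ∑ j, if r j = ∞ then 0 else a j ^ (r j).toReal := by
  classical
  set S : Finset ι := Finset.univ.filter fun j => r j ≠ ∞ with hS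
  have hsum : 1 ≤ ∑ j ∈ S, (r j)⁻¹ := by
    rw [hS, Finset.sum_filter]
    refine hs.trans_eq (Finset.sum_congr rfl fun j _ => ?_)
    by_cases h : r j = ∞ <;> simp [h]
  have hne : S.Nonempty := by
    by_contra h
    rw [Finset.not_nonempty_iff_eq_empty] at h
    simp [h] at hsum
  have hpos : ∀ j ∈ S, 0 < (r j).toReal := fun j hj =>
    ENNReal.toReal_pos (one_pos.trans_le (hr j)).ne' (Finset.mem_filter.1 hj).2
  have hsumR : 1 ≤ ∑ j ∈ S, 1 / (r j).toReal := by
    have h1 : ∀ j ∈ S, (r j)⁻¹ ≠ ∞ := fun j _ => by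
      simpa using (one_pos.trans_le (hr j)).ne'
    have h2 := ENNReal.toReal_mono (ENNReal.sum_ne_top.2 h1) hsum
    rw [ENNReal.toReal_sum h1] at h2
    simpa [ENNReal.toReal_inv] using h2
  obtain ⟨m, hm, hmax⟩ := Finset.exists_max_image S (fun j => a j ^ (r j).toReal) hne
  calc ∏ j, a j ≤ ∏ j ∈ S, a j :=
        Finset.prod_le_prod_of_subset_of_le_one' (Finset.subset_univ _) fun j _ _ => ha j
    _ = ∏ j ∈ S, (a j ^ (r j).toReal) ^ (1 / (r j).toReal) := by
        refine Finset.prod_congr rfl fun j hj => ?_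
        rw [← ENNReal.rpow_mul, mul_one_div_cancel (hpos j hj).ne', ENNReal.rpow_one]
    _ ≤ ∏ j ∈ S, (a m ^ (r m).toReal) ^ (1 / (r j).toReal) := by
        gcongr with j hj
        exact hmax j hj
    _ = (a m ^ (r m).toReal) ^ ∑ j ∈ S, 1 / (r j).toReal :=
        ENNReal.prod_rpow_eq_rpow_sum _ _ _ fun j _ => by positivity
    _ ≤ (a m ^ (r m).toReal) ^ (1 : ℝ) :=
        ENNReal.rpow_le_rpow_of_exponent_ge (ENNReal.rpow_le_one (ha m) (hpos m hm).le) hsumR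
    _ = if r m = ∞ then 0 else a m ^ (r m).toReal := by
        rw [ENNReal.rpow_one, if_neg (Finset.mem_filter.1 hm).2]
    _ ≤ _ := Finset.single_le_sum (f := fun j => if r j = ∞ then 0 else a j ^ (r j).toReal)
        (fun _ _ => zero_le) (Finset.mem_univ m)

theorem ENNReal.prod_tsum_eq_tsum_prod {α : Type*} : ∀ {N : ℕ} (u : Fin N → α → ℝ≥0∞),
    ∏ j, ∑' a, u j a = ∑' n : Fin N → α, ∏ j, u j (n j)
  | 0, u => by simp
  | N + 1, u => by
    rw [← (Fin.consEquiv fun _ => α).tsum_eq, ENNReal.tsum_prod']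
    simp only [Fin.consEquiv_apply, Fin.prod_univ_succ, Fin.cons_zero, Fin.cons_succ]
    rw [ENNReal.prod_tsum_eq_tsum_prod, ← ENNReal.tsum_mul_right]
    simp_rw [ENNReal.tsum_mul_left]

/-- If all the `t i` except possibly one smaller value `t l` are comparable, then a product of
powers of them of total exponent zero, with a non-negative exponent at `l`, is bounded. -/
theorem prod_rpow_le_of_comparable {ι : Type*} [Fintype ι] (t e : ι → ℝ) (K : ℝ)
    (l : ι) (ht : ∀ i, 0 < t i) (hK : 1 ≤ K) (hcomp : ∀ j, j ≠ l → ∀ i, t i ≤ K * t j)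
    (hs : ∑ j, e j = 0) (hl : 0 ≤ e l) :
    ∏ j, t j ^ e j ≤ K ^ ∑ j, |e j| := by
  obtain ⟨m, -, hm⟩ := Finset.exists_max_image Finset.univ t ⟨l, Finset.mem_univ l⟩
  have hK0 : 0 < K := by linarith
  -- Everything is compared with the maximum t m. A negative exponent needs a lower bound on t j,
  -- which is available because it can occur only at j ≠ l.
  have key : ∀ j, t j ^ e j ≤ t m ^ e j * K ^ |e j| := by
    intro j
    rcases le_or_gt 0 (e j) with h | h
    · exact (Real.rpow_le_rpow (ht j).le (hm j (Finset.mem_univ j)) h).trans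
        (le_mul_of_one_le_right (Real.rpow_nonneg (ht m).le _)
          (Real.one_le_rpow hK (abs_nonneg _)))
    · have hjl : j ≠ l := by rintro rfl; linarith
      have h1 : t m / K ≤ t j := by
        rw [div_le_iff₀ hK0, mul_comm]; exact hcomp j hjl m
      refine (Real.rpow_le_rpow_of_nonpos (div_pos (ht m) hK0) h1 h.le).trans_eq ?_
      rw [Real.div_rpow (ht m).le hK0.le, abs_of_neg h, Real.rpow_neg hK0.le, div_eq_mul_inv]
  calc ∏ j, t j ^ e j ≤ ∏ j, (t m ^ e j * K ^ |e j|) :=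
        Finset.prod_le_prod (fun j _ => Real.rpow_nonneg (ht j).le _) fun j _ => key j
    _ = K ^ ∑ j, |e j| := by
        rw [Finset.prod_mul_distrib, ← Real.rpow_sum_of_pos (ht m), hs, Real.rpow_zero, one_mul,
          ← Real.rpow_sum_of_pos hK0]

/-- Take s l = max 0 (d l) and share the remainder ρ = σ - s l, with σ = ∑ d j, among the other
indices in proportion to their room 1 - θ j. The condition `h0` says d l ≤ σ, whence ρ ≥ 0. The
total room is c = (card ι - 3) + σ + θ l > σ, because numbers below 1 with sum 2 must be at least
three. -/
theorem exists_nonneg_exponents {ι : Type*} [Fintype ι] [DecidableEq ι] (θ d : ι → ℝ)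
    (hθ0 : ∀ j, 0 < θ j) (hθ1 : ∀ j, θ j < 1) (hs : ∑ j, (θ j + d j) = 2)
    (h1 : ∀ l, θ l + d l < 1) (h0 : ∀ l, 0 ≤ ∑ j ∈ Finset.univ.erase l, d j) (l : ι) :
    ∃ s : ι → ℝ, (∀ j, 0 ≤ s j) ∧ (∀ j, θ j + s j < 1) ∧ ∑ j, (θ j + s j) = 2 ∧ d l ≤ s l := by
  have hcard : 3 ≤ Fintype.card ι := by
    by_contra hlt
    have hne : (Finset.univ : Finset ι).Nonempty := ⟨l, Finset.mem_univ l⟩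
    have h2 : ∑ j, (θ j + d j) < ∑ _j : ι, (1 : ℝ) :=
      Finset.sum_lt_sum_of_nonempty hne fun j _ => h1 j
    have h3 : (Fintype.card ι : ℝ) ≤ 2 := by exact_mod_cast (by omega : Fintype.card ι ≤ 2)
    rw [hs, Finset.sum_const, Finset.card_univ, nsmul_eq_mul, mul_one] at h2
    linarith
  have hcard' : (3 : ℝ) ≤ Fintype.card ι := by exact_mod_cast hcard
  set σ := ∑ j, d j with hσ
  have hθσ : ∑ j, θ j = 2 - σ := by rw [Finset.sum_add_distrib] at hs; linarith
  have hdl : ∀ j, d j ≤ σ := fun j => by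
    have := Finset.add_sum_erase Finset.univ d (Finset.mem_univ j)
    linarith [h0 j]
  have hσ0 : 0 ≤ σ := by
    have h2 : ∑ j, d j ≤ ∑ _j : ι, σ := Finset.sum_le_sum fun j _ => hdl j
    simp at h2
    nlinarith
  set ρ := σ - max 0 (d l) with hρ
  have hρ0 : 0 ≤ ρ := sub_nonneg.2 (max_le hσ0 (hdl l))
  have hρσ : ρ ≤ σ := by linarith [le_max_left 0 (d l)]
  set c := ∑ j ∈ Finset.univ.erase l, (1 - θ j) with hc
  have hcσ : σ < c := by
    have h2 := Finset.add_sum_erase Finset.univ (fun j => 1 - θ j) (Finset.mem_univ l)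
    rw [← hc, Finset.sum_sub_distrib, hθσ, Finset.sum_const, Finset.card_univ, nsmul_eq_mul,
      mul_one] at h2
    linarith [hθ0 l]
  have hc0 : 0 < c := by linarith
  have hq : ρ / c < 1 := (div_lt_one hc0).2 (by linarith)
  have hq0 : 0 ≤ ρ / c := div_nonneg hρ0 hc0.le
  refine ⟨fun j => if j = l then max 0 (d l) else ρ / c * (1 - θ j), fun j => ?_, fun j => ?_, ?_,
    by simp⟩
  · dsimp only
    split_ifs
    · exact le_max_left _ _
    · exact mul_nonneg hq0 (by linarith [hθ1 j])
  · dsimp only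
    split_ifs with h
    · subst h
      rcases max_cases 0 (d j) with h | h <;> linarith [hθ1 j, h1 j]
    · nlinarith [hθ1 j]
  · rw [Finset.sum_add_distrib, hθσ, ← Finset.add_sum_erase Finset.univ _ (Finset.mem_univ l),
      if_pos rfl, Finset.sum_congr rfl fun j hj => if_neg (Finset.ne_of_mem_erase hj),
      ← Finset.mul_sum, ← hc, div_mul_cancel₀ _ hc0.ne', hρ]
    ring

/-! ### Power weights -/

theorem lintegral_ball_enorm_rpow {k : ℕ} (a : ℝ) {R : ℝ} (hR : 0 < R) :
    ∫⁻ y in Metric.ball (0 : EuclideanSpace ℝ (Fin k)) R, ‖y‖ₑ ^ (-a) =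
      ENNReal.ofReal (R ^ (k - a)) *
        ∫⁻ y in Metric.ball (0 : EuclideanSpace ℝ (Fin k)) 1, ‖y‖ₑ ^ (-a) := by
  set g : EuclideanSpace ℝ (Fin k) → ℝ≥0∞ := fun y => ‖y‖ₑ ^ (-a)
  have hg : Measurable g := by fun_prop
  have hmap := Measure.map_addHaar_smul (volume : Measure (EuclideanSpace ℝ (Fin k))) hR.ne'
  have h1 : ∫⁻ y, (Metric.ball (0 : EuclideanSpace ℝ (Fin k)) R).indicator g y
      ∂(Measure.map (R • ·) volume) =
      ENNReal.ofReal (R ^ (-a)) * ∫⁻ y in Metric.ball (0 : EuclideanSpace ℝ (Fin k)) 1, g y := by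
    rw [lintegral_map (hg.indicator measurableSet_ball) (measurable_const_smul R),
      ← lintegral_const_mul _ hg, ← lintegral_indicator measurableSet_ball]
    refine lintegral_congr fun y => ?_
    have hy : R • y ∈ Metric.ball (0 : EuclideanSpace ℝ (Fin k)) R ↔
        y ∈ Metric.ball (0 : EuclideanSpace ℝ (Fin k)) 1 := by
      simp [norm_smul, abs_of_pos hR, hR]
    by_cases h : y ∈ Metric.ball (0 : EuclideanSpace ℝ (Fin k)) 1
    · rw [Set.indicator_of_mem h, Set.indicator_of_mem (hy.2 h)]
      simp only [g]
      rw [enorm_smul, ENNReal.mul_rpow_of_ne_top (by simp) (by simp),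
        Real.enorm_eq_ofReal hR.le, ENNReal.ofReal_rpow_of_pos hR]
    · rw [Set.indicator_of_notMem h, Set.indicator_of_notMem (fun h' => h (hy.1 h'))]
  rw [hmap, lintegral_smul_measure, lintegral_indicator measurableSet_ball, smul_eq_mul] at h1
  have h2 : ENNReal.ofReal (R ^ (k : ℝ)) * ENNReal.ofReal
      |(R ^ Module.finrank ℝ (EuclideanSpace ℝ (Fin k)))⁻¹| = 1 := by
    rw [finrank_euclideanSpace_fin, Real.rpow_natCast, abs_of_pos (by positivity),
      ← ENNReal.ofReal_mul (by positivity), mul_inv_cancel₀ (by positivity), ENNReal.ofReal_one]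
  rw [← one_mul (∫⁻ y in Metric.ball (0 : EuclideanSpace ℝ (Fin k)) R, g y), ← h2, mul_assoc, h1,
    ← mul_assoc, ← ENNReal.ofReal_mul (by positivity), ← Real.rpow_add hR, sub_eq_add_neg]

/-- Split E at the ball whose radius R satisfies R ^ k = M. Inside, scaling gives a multiple of M ^
(1 - γ), finite since k γ < k; outside, the weight is at most M ^ (-γ) on a set of measure at most
M, which accounts for the `+ 1` in the constant. -/
theorem exists_lintegral_enorm_rpow_le {k : ℕ} (hk : 0 < k) {γ : ℝ} (hγ0 : 0 ≤ γ) (hγ1 : γ < 1) :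
    ∃ C : ℝ≥0, ∀ (M : ℝ) (E : Set (EuclideanSpace ℝ (Fin k))), 0 < M → MeasurableSet E →
      volume E ≤ ENNReal.ofReal M →
        ∫⁻ y in E, ‖y‖ₑ ^ (-(k * γ)) ≤ C * ENNReal.ofReal (M ^ (1 - γ)) := by
  have hk' : (0 : ℝ) < k := by exact_mod_cast hk
  set g : EuclideanSpace ℝ (Fin k) → ℝ≥0∞ := fun y => ‖y‖ₑ ^ (-(k * γ)) with hgdef
  have hg : Measurable g := by fun_prop
  have hfin : ∫⁻ y in Metric.ball (0 : EuclideanSpace ℝ (Fin k)) 1, g y ≠ ∞ := by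
    have h := integrableOn_ball_of_norm_le_rpow (E := EuclideanSpace ℝ (Fin k)) (μ := volume)
      (f := fun x => ‖x‖ ^ (-(k * γ))) (C := 1) (α := k * γ) (r := 1)
      (by rw [finrank_euclideanSpace_fin]; exact hk)
      (by rw [finrank_euclideanSpace_fin]; nlinarith)
      (Filter.Eventually.of_forall fun x => by
        rw [one_mul, Real.norm_of_nonneg (Real.rpow_nonneg (norm_nonneg _) _)])
      (measurable_norm.pow_const _).aestronglyMeasurable
    have : Nontrivial (EuclideanSpace ℝ (Fin k)) :=
      Module.nontrivial_of_finrank_pos (R := ℝ) (by rw [finrank_euclideanSpace_fin]; exact hk)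
    refine ne_of_lt (lt_of_le_of_lt (lintegral_mono_ae ?_) h.2)
    -- The origin is discarded because there a negative power is ∞ in `ℝ≥0∞` but 0 in `ℝ`.
    refine ae_restrict_of_ae ?_
    filter_upwards [compl_mem_ae_iff.2 (measure_singleton (0 : EuclideanSpace ℝ (Fin k)))] with x hx
    have hx0 : 0 < ‖x‖ := norm_pos_iff.2 hx
    rw [Real.enorm_eq_ofReal (Real.rpow_nonneg (norm_nonneg _) _),
      ← ENNReal.ofReal_rpow_of_pos hx0, ofReal_norm]
  refine ⟨(∫⁻ y in Metric.ball (0 : EuclideanSpace ℝ (Fin k)) 1, g y).toNNReal + 1,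
    fun M E hM hE hvol => ?_⟩
  set R : ℝ := M ^ (1 / (k : ℝ)) with hRdef
  have hR : 0 < R := by positivity
  have hRa : ∀ b : ℝ, R ^ (k * b) = M ^ b := fun b => by
    rw [hRdef, ← Real.rpow_mul hM.le]
    congr 1
    field_simp
  have hball := lintegral_ball_enorm_rpow (k := k) (k * γ) hR
  rw [show (k : ℝ) - k * γ = k * (1 - γ) by ring, hRa] at hball
  calc ∫⁻ y in E, g y
      ≤ ∫⁻ y in Metric.ball 0 R ∪ E \ Metric.ball 0 R, g y :=
        lintegral_mono_set (by intro y hy; by_cases h : y ∈ Metric.ball 0 R <;> simp_all)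
    _ ≤ (∫⁻ y in Metric.ball 0 R, g y) + ∫⁻ y in E \ Metric.ball 0 R, g y :=
        lintegral_union_le _ _ _
    _ ≤ (∫⁻ y in Metric.ball 0 R, g y) + ∫⁻ y in E, ENNReal.ofReal (M ^ (-γ)) := by
        refine add_le_add_right ?_ _
        refine (setLIntegral_mono' (hE.diff measurableSet_ball) fun y hy => ?_).trans
          (lintegral_mono_set Set.sdiff_subset)
        have hy1 : R ≤ ‖y‖ := by simpa using hy.2
        simp only [hgdef]
        rw [← ofReal_norm, ENNReal.ofReal_rpow_of_pos (hR.trans_le hy1)]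
        refine ENNReal.ofReal_le_ofReal ?_
        rw [← hRa, mul_neg]
        exact Real.rpow_le_rpow_of_nonpos hR hy1 (by nlinarith)
    _ ≤ _ := by
        rw [hball, setLIntegral_const, ENNReal.coe_add, ENNReal.coe_toNNReal hfin, add_mul,
          mul_comm (ENNReal.ofReal _)]
        refine add_le_add_right ?_ _
        rw [ENNReal.coe_one, one_mul, sub_eq_neg_add, Real.rpow_add hM, Real.rpow_one,
          ENNReal.ofReal_mul (by positivity)]
        gcongr

/-! ### Linear forms with values in `ℝᵏ` -/

/-- The map `x ↦ a · x = a¹ x¹ + a² x²`. -/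
def linForm (V : Type*) [AddCommGroup V] [Module ℝ V] (a : Fin 2 → ℝ) : V × V →ₗ[ℝ] V :=
  a 0 • LinearMap.fst ℝ V V + a 1 • LinearMap.snd ℝ V V

theorem linForm_apply {V : Type*} [AddCommGroup V] [Module ℝ V] (a : Fin 2 → ℝ) (x : V × V) :
    linForm V a x = a 0 • x.1 + a 1 • x.2 := rfl

theorem det_ne_zero_of_linearIndependent {a b : Fin 2 → ℝ} (h : LinearIndependent ℝ ![a, b]) :
    a 0 * b 1 - a 1 * b 0 ≠ 0 := by
  rw [LinearIndependent.pair_iff] at h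
  intro h0
  have h1 := h (b 1) (-a 1) (by
    ext i; fin_cases i <;> simp <;> linarith)
  have h2 := h (b 0) (-a 0) (by
    ext i; fin_cases i <;> simp <;> linarith)
  have h3 := h 1 0 (by
    ext i
    fin_cases i
    · simpa using h2.2
    · simpa using h1.2)
  exact one_ne_zero h3.1

/-- Cramer's rule gives a right inverse acting blockwise, and multiplicativity of the determinant
makes a one-sided inverse sufficient. -/
theorem det_prod_linForm_ne_zero {V : Type*} [AddCommGroup V] [Module ℝ V] {a b : Fin 2 → ℝ}
    (h : LinearIndependent ℝ ![a, b]) :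
    LinearMap.det ((linForm V a).prod (linForm V b)) ≠ 0 := by
  have hD := det_ne_zero_of_linearIndependent h
  set D := a 0 * b 1 - a 1 * b 0 with hDdef
  have hcomp : ((linForm V a).prod (linForm V b)).comp
      ((linForm V ![b 1 / D, -a 1 / D]).prod (linForm V ![-b 0 / D, a 0 / D])) =
      LinearMap.id := by
    refine LinearMap.ext fun x => Prod.ext ?_ ?_
    · change linForm V a (linForm V ![b 1 / D, -a 1 / D] x, linForm V ![-b 0 / D, a 0 / D] x) = x.1
      simp only [linForm_apply, Matrix.cons_val_zero, Matrix.cons_val_one]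
      match_scalars
      · field_simp; rw [hDdef]; ring
      · field_simp; ring
    · change linForm V b (linForm V ![b 1 / D, -a 1 / D] x, linForm V ![-b 0 / D, a 0 / D] x) = x.2
      simp only [linForm_apply, Matrix.cons_val_zero, Matrix.cons_val_one]
      match_scalars
      · field_simp; ring
      · field_simp; rw [hDdef]; ring
  intro h0
  have := congrArg LinearMap.det hcomp
  rw [LinearMap.det_comp, h0, zero_mul, LinearMap.det_id] at this
  exact zero_ne_one this

section
variable {V : Type*} [NormedAddCommGroup V] [InnerProductSpace ℝ V] [FiniteDimensional ℝ V]
  [MeasurableSpace V] [BorelSpace V]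

theorem measurable_linForm (a : Fin 2 → ℝ) : Measurable (linForm V a) := by
  simp only [funext (linForm_apply (V := V) a)]
  fun_prop

theorem map_prod_linForm {a b : Fin 2 → ℝ} (h : LinearIndependent ℝ ![a, b]) :
    ∃ c : ℝ≥0, Measure.map (fun x : V × V => (linForm V a x, linForm V b x)) volume =
      (c : ℝ≥0∞) • (volume : Measure (V × V)) :=
  haveI : (volume : Measure (V × V)).IsAddHaarMeasure :=
    inferInstanceAs ((volume : Measure V).prod volume).IsAddHaarMeasure
  ⟨_, Measure.map_linearMap_addHaar_eq_smul_addHaar volume (det_prod_linForm_ne_zero (V := V) h)⟩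

theorem exists_lintegral_mul_linForm_le {a b : Fin 2 → ℝ} (h : LinearIndependent ℝ ![a, b]) :
    ∃ c : ℝ≥0, ∀ F G : V → ℝ≥0∞, Measurable F → Measurable G →
      ∫⁻ x : V × V, F (linForm V a x) * G (linForm V b x) =
        c * ((∫⁻ y, F y) * ∫⁻ y, G y) := by
  obtain ⟨c, hc⟩ := map_prod_linForm (V := V) h
  refine ⟨c, fun F G hF hG => ?_⟩
  have hm : Measurable fun x : V × V => (linForm V a x, linForm V b x) :=
    (measurable_linForm a).prodMk (measurable_linForm b)
  have h1 := lintegral_map (μ := (volume : Measure (V × V)))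
    (f := fun z : V × V => F z.1 * G z.2) (by fun_prop) hm
  rw [← h1, hc, lintegral_smul_measure, smul_eq_mul, Measure.volume_eq_prod,
    lintegral_prod_mul hF.aemeasurable hG.aemeasurable]

theorem ae_linForm {a b : Fin 2 → ℝ} (h : LinearIndependent ℝ ![a, b]) {P : V → Prop}
    (hP : ∀ᵐ y, P y) : ∀ᵐ x : V × V, P (linForm V a x) := by
  obtain ⟨c, hc⟩ := map_prod_linForm (V := V) h
  have hm : Measurable fun x : V × V => (linForm V a x, linForm V b x) :=
    (measurable_linForm a).prodMk (measurable_linForm b)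
  have h1 : ∀ᵐ z : V × V, P z.1 := by
    rw [Measure.volume_eq_prod]
    exact Measure.quasiMeasurePreserving_fst.ae hP
  have h2 : ∀ᵐ z ∂(Measure.map (fun x : V × V => (linForm V a x, linForm V b x)) volume),
      P z.1 := by
    rw [hc]
    exact Measure.ae_smul_measure h1 _
  exact ae_of_ae_map hm.aemeasurable h2

end

section
variable {V : Type*} [NormedAddCommGroup V] [InnerProductSpace ℝ V]

/-- If `a`, `b` form a basis, then `c · x` is controlled by `a · x` and `b · x`. -/
theorem exists_norm_linForm_le {a b : Fin 2 → ℝ} (h : LinearIndependent ℝ ![a, b])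
    (c : Fin 2 → ℝ) : ∃ K : ℝ, 0 ≤ K ∧ ∀ x : V × V,
      ‖linForm V c x‖ ≤ K * (‖linForm V a x‖ + ‖linForm V b x‖) := by
  have hD := det_ne_zero_of_linearIndependent h
  set D := a 0 * b 1 - a 1 * b 0 with hDdef
  set s := (c 0 * b 1 - c 1 * b 0) / D with hs
  set t := (a 0 * c 1 - a 1 * c 0) / D with ht
  refine ⟨|s| + |t|, by positivity, fun x => ?_⟩
  have hx : linForm V c x = s • linForm V a x + t • linForm V b x := by
    simp only [linForm_apply]
    match_scalars
    · rw [hs, ht]; field_simp; rw [hDdef]; ring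
    · rw [hs, ht]; field_simp; rw [hDdef]; ring
  rw [hx]
  refine (norm_add_le _ _).trans ?_
  rw [norm_smul, norm_smul, Real.norm_eq_abs, Real.norm_eq_abs]
  nlinarith [mul_nonneg (abs_nonneg s) (norm_nonneg (linForm V b x)),
    mul_nonneg (abs_nonneg t) (norm_nonneg (linForm V a x))]

/-- For pairwise independent vectors, all `v j · x` except the smallest are comparable. -/
theorem exists_linForm_comparable {ι : Type*} [Fintype ι] (v : ι → Fin 2 → ℝ)
    (hv : ∀ i j, i ≠ j → LinearIndependent ℝ ![v i, v j]) :
    ∃ K : ℝ, 1 ≤ K ∧ ∀ (x : V × V) (l : ι),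
      (∀ j, ‖linForm V (v l) x‖ ≤ ‖linForm V (v j) x‖) →
        ∀ j, j ≠ l → ∀ i, ‖linForm V (v i) x‖ ≤ K * ‖linForm V (v j) x‖ := by
  have hex : ∀ q : ι × ι × ι, ∃ K : ℝ, 0 ≤ K ∧ (q.2.1 ≠ q.1 → ∀ x : V × V,
      ‖linForm V (v q.2.2) x‖ ≤ K * (‖linForm V (v q.1) x‖ + ‖linForm V (v q.2.1) x‖)) := by
    intro q
    by_cases h : q.2.1 = q.1
    · exact ⟨0, le_rfl, fun h' => absurd h h'⟩
    · obtain ⟨K, hK0, hK⟩ := exists_norm_linForm_le (V := V) (hv _ _ (Ne.symm h)) (v q.2.2)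
      exact ⟨K, hK0, fun _ => hK⟩
  choose K hK0 hK using hex
  have hsum : 0 ≤ ∑ q, K q := Finset.sum_nonneg fun q _ => hK0 q
  -- Summing over all triples makes the constant uniform; the 2 comes from bounding the smallest
  -- norm by that of v j.
  refine ⟨1 + 2 * ∑ q, K q, by linarith, fun x l hl j hj i => ?_⟩
  have h1 := hK (l, j, i) hj x
  have h2 : K (l, j, i) ≤ ∑ q, K q :=
    Finset.single_le_sum (fun q _ => hK0 q) (Finset.mem_univ _)
  have h3 := hl j
  have h4 := norm_nonneg (linForm V (v j) x)
  have h5 := hK0 (l, j, i)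
  simp only at h1
  calc ‖linForm V (v i) x‖ ≤ K (l, j, i) * (‖linForm V (v l) x‖ + ‖linForm V (v j) x‖) := h1
    _ ≤ K (l, j, i) * (‖linForm V (v j) x‖ + ‖linForm V (v j) x‖) := by gcongr
    _ = 2 * K (l, j, i) * ‖linForm V (v j) x‖ := by ring
    _ ≤ (1 + 2 * ∑ q, K q) * ‖linForm V (v j) x‖ := by
        gcongr
        linarith

end

/-! ### The estimate for weighted characteristic functions -/

/-- Pointwise heart of the estimate, on the region where l is the smallest index. The factors t j ^
(k * s j - lam j) have total degree zero and a nonnegative exponent at l, so their product is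
bounded; the remaining t j ^ (-(k * s j)) are written as M j ^ θ j times a power θ j + s j of the
normalised functions, to which `prod_rpow_le_sum_mul` applies. -/
theorem prod_weight_le {ι : Type*} [Fintype ι] [DecidableEq ι] (t lam θ s M : ι → ℝ) (k K : ℝ)
    (l : ι) (ht : ∀ i, 0 < t i) (hM : ∀ i, 0 < M i) (hK : 1 ≤ K)
    (hcomp : ∀ j, j ≠ l → ∀ i, t i ≤ K * t j) (hθ0 : ∀ j, 0 < θ j) (hs0 : ∀ j, 0 ≤ s j)
    (hs1 : ∀ j, θ j + s j < 1) (hs2 : ∑ j, (θ j + s j) = 2)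
    (hs : ∑ j, (k * s j - lam j) = 0) (hl : lam l ≤ k * s l) :
    ∏ j, ENNReal.ofReal (t j) ^ (-lam j) ≤
      ENNReal.ofReal (K ^ ∑ j, |k * s j - lam j|) * (∏ j, ENNReal.ofReal (M j ^ θ j)) *
        ∑ a, ∑ b ∈ Finset.univ.erase a,
          (ENNReal.ofReal (t a) ^ (-(k * (s a / (θ a + s a)))) *
            ENNReal.ofReal (M a ^ (-(θ a / (θ a + s a))))) *
          (ENNReal.ofReal (t b) ^ (-(k * (s b / (θ b + s b)))) *
            ENNReal.ofReal (M b ^ (-(θ b / (θ b + s b))))) := by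
  have hβ : ∀ j, 0 < θ j + s j := fun j => by linarith [hθ0 j, hs0 j]
  have hfac : ∀ j, ENNReal.ofReal (t j) ^ (-lam j) =
      ENNReal.ofReal (t j ^ (k * s j - lam j)) * (ENNReal.ofReal (M j ^ θ j) *
        (ENNReal.ofReal (t j) ^ (-(k * (s j / (θ j + s j)))) *
            ENNReal.ofReal (M j ^ (-(θ j / (θ j + s j))))) ^ (θ j + s j)) := by
    intro j
    have h1 := ht j
    have h2 := hM j
    have h3 := hβ j
    rw [ENNReal.ofReal_rpow_of_pos h1, ENNReal.ofReal_rpow_of_pos h1,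
      ← ENNReal.ofReal_mul (by positivity), ENNReal.ofReal_rpow_of_pos (by positivity),
      ← ENNReal.ofReal_mul (by positivity), ← ENNReal.ofReal_mul (by positivity),
      Real.mul_rpow (by positivity) (by positivity), ← Real.rpow_mul h1.le, ← Real.rpow_mul h2.le,
      show -(θ j / (θ j + s j)) * (θ j + s j) = -θ j by field_simp,
      show -(k * (s j / (θ j + s j))) * (θ j + s j) = -(k * s j) by field_simp,
      mul_left_comm (M j ^ θ j), ← Real.rpow_add h2, add_neg_cancel, Real.rpow_zero, mul_one,
      ← Real.rpow_add h1]
    congr 2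
    ring
  calc ∏ j, ENNReal.ofReal (t j) ^ (-lam j)
      = ENNReal.ofReal (∏ j, t j ^ (k * s j - lam j)) * ((∏ j, ENNReal.ofReal (M j ^ θ j)) *
          ∏ j, (ENNReal.ofReal (t j) ^ (-(k * (s j / (θ j + s j)))) *
            ENNReal.ofReal (M j ^ (-(θ j / (θ j + s j))))) ^ (θ j + s j)) := by
        rw [Finset.prod_congr rfl fun j _ => hfac j, Finset.prod_mul_distrib,
          Finset.prod_mul_distrib, ENNReal.ofReal_prod_of_nonneg fun j _ =>
            Real.rpow_nonneg (ht j).le _]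
    _ ≤ _ := by
        rw [mul_assoc]
        gcongr ENNReal.ofReal ?_ * (_ * ?_)
        · exact prod_rpow_le_of_comparable t _ K l ht hK hcomp hs (by linarith)
        · exact prod_rpow_le_sum_mul _ _ (fun j => (hβ j).le) (fun j => (hs1 j).le) hs2

/-- With γ = s / (θ + s) < 1 the integral of the weight is O(M ^ (1 - γ)), and 1 - γ = θ / (θ + s)
is exactly the power removed by the normalising factor. -/
theorem exists_lintegral_weight_indicator_le {k : ℕ} (hk : 0 < k) {θ s : ℝ} (hθ : 0 < θ)
    (hs : 0 ≤ s) :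
    ∃ C : ℝ≥0, ∀ (M : ℝ) (E : Set (EuclideanSpace ℝ (Fin k))), 0 < M → MeasurableSet E →
      volume E ≤ ENNReal.ofReal M →
        ∫⁻ y, E.indicator (fun y => ‖y‖ₑ ^ (-(k * (s / (θ + s)))) *
          ENNReal.ofReal (M ^ (-(θ / (θ + s))))) y ≤ C := by
  have hβ : 0 < θ + s := by linarith
  obtain ⟨C, hC⟩ := exists_lintegral_enorm_rpow_le (k := k) hk (γ := s / (θ + s))
    (by positivity) ((div_lt_one hβ).2 (by linarith))
  refine ⟨C, fun M E hM hE hvol => ?_⟩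
  rw [lintegral_indicator hE, lintegral_mul_const _ (by fun_prop)]
  refine (mul_le_mul_left (hC M E hM hE hvol) _).trans_eq ?_
  rw [mul_assoc, ← ENNReal.ofReal_mul (by positivity), ← Real.rpow_add hM,
    show 1 - s / (θ + s) + -(θ / (θ + s)) = 0 by field_simp; ring, Real.rpow_zero,
    ENNReal.ofReal_one, mul_one]

/-- Provides each v j with an independent partner, as needed to pull null sets back through x ↦ v j
· x by `ae_linForm`. -/
theorem exists_ne_of_sum_eq_two {ι : Type*} [Fintype ι] (g : ι → ℝ) (hs : ∑ j, g j = 2)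
    (h1 : ∀ j, g j < 1) (j : ι) : ∃ b, j ≠ b := by
  by_contra! hall
  rw [Finset.sum_eq_single j (fun b _ hb => absurd (hall b).symm hb) (by simp)] at hs
  linarith [h1 j]

theorem exists_lintegral_prod_indicator_le {k : ℕ} (hk : 0 < k) {ι : Type*} [Fintype ι]
    [DecidableEq ι] (v : ι → Fin 2 → ℝ)
    (hv : ∀ i j, i ≠ j → LinearIndependent ℝ ![v i, v j]) (θ lam : ι → ℝ)
    (hθ0 : ∀ j, 0 < θ j) (hθ1 : ∀ j, θ j < 1) (hs : ∑ j, (θ j + lam j / (k : ℝ)) = 2)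
    (h1 : ∀ l, θ l + lam l / (k : ℝ) < 1) (h0 : ∀ l, 0 ≤ ∑ j ∈ Finset.univ.erase l, lam j) :
    ∃ C : ℝ≥0, ∀ (M : ι → ℝ) (E : ι → Set (EuclideanSpace ℝ (Fin k))), (∀ j, 0 < M j) →
      (∀ j, MeasurableSet (E j)) → (∀ j, volume (E j) ≤ ENNReal.ofReal (M j)) →
        ∫⁻ x : EuclideanSpace ℝ (Fin k) × EuclideanSpace ℝ (Fin k),
          ∏ j, (E j).indicator (fun y => ‖y‖ₑ ^ (-lam j)) (linForm _ (v j) x) ≤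
            C * ∏ j, ENNReal.ofReal (M j ^ θ j) := by
  have hk' : (0 : ℝ) < k := by exact_mod_cast hk
  have hV : Nontrivial (EuclideanSpace ℝ (Fin k)) :=
    Module.nontrivial_of_finrank_pos (R := ℝ) (by rw [finrank_euclideanSpace_fin]; exact hk)
  have h0' : ∀ l, 0 ≤ ∑ j ∈ Finset.univ.erase l, lam j / (k : ℝ) := fun l => by
    rw [← Finset.sum_div]; exact div_nonneg (h0 l) hk'.le
  have hne : (Finset.univ : Finset ι).Nonempty := by
    by_contra h
    rw [Finset.not_nonempty_iff_eq_empty] at h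
    simp [h] at hs
  -- The exponents depend on which index l is smallest at x; summing the resulting bounds over l
  -- covers all regions at once.
  choose s hs0 hs1 hs2 hsl using exists_nonneg_exponents θ (fun j => lam j / k) hθ0 hθ1 hs h1 h0'
  choose Cw hCw using fun l j =>
    exists_lintegral_weight_indicator_le (k := k) hk (hθ0 j) (hs0 l j)
  have hc : ∀ a b, ∃ c : ℝ≥0, a ≠ b → ∀ F G : EuclideanSpace ℝ (Fin k) → ℝ≥0∞, Measurable F → Measurable G →
      ∫⁻ x : EuclideanSpace ℝ (Fin k) × EuclideanSpace ℝ (Fin k), F (linForm _ (v a) x) * G (linForm _ (v b) x) =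
        c * ((∫⁻ y, F y) * ∫⁻ y, G y) := by
    intro a b
    by_cases hab : a = b
    · exact ⟨0, fun h => absurd hab h⟩
    · obtain ⟨c, hc⟩ := exists_lintegral_mul_linForm_le (V := EuclideanSpace ℝ (Fin k)) (hv a b hab)
      exact ⟨c, fun _ => hc⟩
  choose c hc using hc
  obtain ⟨K, hK1, hK⟩ := exists_linForm_comparable (V := EuclideanSpace ℝ (Fin k)) v hv
  have hae : ∀ᵐ x : EuclideanSpace ℝ (Fin k) × EuclideanSpace ℝ (Fin k), ∀ j, linForm _ (v j) x ≠ 0 := by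
    rw [ae_all_iff]
    intro j
    obtain ⟨b, hb⟩ := exists_ne_of_sum_eq_two _ hs h1 j
    exact ae_linForm (hv j b hb) (compl_mem_ae_iff.2 (measure_singleton (0 : EuclideanSpace ℝ (Fin k))))
  refine ⟨∑ l, Real.toNNReal (K ^ ∑ j, |k * s l j - lam j|) *
    ∑ a, ∑ b ∈ Finset.univ.erase a, c a b * (Cw l a * Cw l b), fun M E hM hE hvol => ?_⟩
  set F : ι → ι → EuclideanSpace ℝ (Fin k) → ℝ≥0∞ := fun l j => (E j).indicator fun y =>
    ‖y‖ₑ ^ (-(k * (s l j / (θ j + s l j)))) * ENNReal.ofReal (M j ^ (-(θ j / (θ j + s l j))))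
    with hF
  have hFm : ∀ l j, Measurable (F l j) := fun l j => Measurable.indicator (by fun_prop) (hE j)
  have hFint : ∀ l j, ∫⁻ y, F l j y ≤ Cw l j := fun l j => hCw l j (M j) (E j) (hM j) (hE j) (hvol j)
  have hFl : ∀ l j, Measurable fun x : EuclideanSpace ℝ (Fin k) × EuclideanSpace ℝ (Fin k) => F l j (linForm _ (v j) x) := fun l j =>
    (hFm l j).comp (measurable_linForm (v j))
  have hsum : ∀ l, ∑ j, (k * s l j - lam j) = 0 := by
    intro l
    have h2 := hs2 l
    rw [← hs, Finset.sum_add_distrib, Finset.sum_add_distrib, add_right_inj,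
      ← Finset.sum_div, eq_div_iff hk'.ne'] at h2
    rw [Finset.sum_sub_distrib, ← Finset.mul_sum, mul_comm, h2, sub_self]
  set P := ∏ j, ENNReal.ofReal (M j ^ θ j) with hP
  calc ∫⁻ x : EuclideanSpace ℝ (Fin k) × EuclideanSpace ℝ (Fin k), ∏ j, (E j).indicator (fun y => ‖y‖ₑ ^ (-lam j)) (linForm _ (v j) x)
      ≤ ∫⁻ x : EuclideanSpace ℝ (Fin k) × EuclideanSpace ℝ (Fin k), ∑ l, ENNReal.ofReal (K ^ ∑ j, |k * s l j - lam j|) * P *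
          ∑ a, ∑ b ∈ Finset.univ.erase a,
            F l a (linForm _ (v a) x) * F l b (linForm _ (v b) x) := by
        refine lintegral_mono_ae (hae.mono fun x hx => ?_)
        by_cases hxE : ∀ j, linForm _ (v j) x ∈ E j
        · obtain ⟨l, -, hl⟩ := Finset.exists_min_image Finset.univ
            (fun j => ‖linForm _ (v j) x‖) hne
          refine le_trans ?_ (Finset.single_le_sum (f := fun l =>
            ENNReal.ofReal (K ^ ∑ j, |k * s l j - lam j|) * P *
              ∑ a, ∑ b ∈ Finset.univ.erase a,
                F l a (linForm _ (v a) x) * F l b (linForm _ (v b) x))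
              (fun _ _ => zero_le) (Finset.mem_univ l))
          have h2 := prod_weight_le (fun j => ‖linForm _ (v j) x‖) lam θ (s l) M k K l
            (fun i => norm_pos_iff.2 (hx i)) hM hK1
            (hK x l fun j => hl j (Finset.mem_univ j)) hθ0 (hs0 l) (hs1 l) (hs2 l) (hsum l)
            (by have := hsl l; rw [div_le_iff₀ hk'] at this; linarith)
          simp only [ofReal_norm] at h2
          simp only [hF, Set.indicator_of_mem (hxE _)]
          exact h2
        · push Not at hxE
          obtain ⟨j, hj⟩ := hxE
          rw [Finset.prod_eq_zero (Finset.mem_univ j) (Set.indicator_of_notMem hj _)]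
          exact zero_le
    _ = ∑ l, ENNReal.ofReal (K ^ ∑ j, |k * s l j - lam j|) * P *
          ∑ a, ∑ b ∈ Finset.univ.erase a,
            ∫⁻ x : EuclideanSpace ℝ (Fin k) × EuclideanSpace ℝ (Fin k), F l a (linForm _ (v a) x) * F l b (linForm _ (v b) x) := by
        rw [lintegral_finsetSum' _ fun l _ => ?_]
        · refine Finset.sum_congr rfl fun l _ => ?_
          rw [lintegral_const_mul _ (by fun_prop), lintegral_finsetSum _ (by fun_prop)]
          congr 1
          refine Finset.sum_congr rfl fun a _ => ?_
          rw [lintegral_finsetSum _ (by fun_prop)]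
        · fun_prop
    _ ≤ ∑ l, ENNReal.ofReal (K ^ ∑ j, |k * s l j - lam j|) * P *
          ∑ a, ∑ b ∈ Finset.univ.erase a, (c a b : ℝ≥0∞) * (Cw l a * Cw l b) := by
        gcongr with l _ a _ b hb
        rw [hc a b (Finset.ne_of_mem_erase hb).symm _ _ (hFm l a) (hFm l b)]
        gcongr
        · exact hFint l a
        · exact hFint l b
    _ = _ := by
        push_cast
        rw [Finset.sum_mul]
        refine Finset.sum_congr rfl fun l _ => ?_
        rw [mul_right_comm]
        rfl

theorem exists_pos_lt_of_finite {ι : Type*} [Fintype ι] (g : ι → ℝ) (hg : ∀ j, 0 < g j) :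
    ∃ ε : ℝ, 0 < ε ∧ ∀ j, ε < g j := by
  have h : ∀ᶠ ε in nhdsWithin (0 : ℝ) (Set.Ioi 0), ∀ j, ε < g j :=
    Filter.eventually_all.2 fun j => nhdsWithin_le_nhds (eventually_lt_nhds (hg j))
  obtain ⟨ε, h1, h2⟩ := (h.and self_mem_nhdsWithin).exists
  exact ⟨ε, h2, h1⟩

/-- The estimate for weighted characteristic functions of sets of dyadic measure, with decay
when the measures are far apart. -/
theorem exists_lintegral_prod_indicator_le_decay {k : ℕ} (hk : 0 < k) {ι : Type*} [Fintype ι]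
    [DecidableEq ι] (v : ι → Fin 2 → ℝ)
    (hv : ∀ i j, i ≠ j → LinearIndependent ℝ ![v i, v j]) (θ lam : ι → ℝ)
    (hθ0 : ∀ j, 0 < θ j) (hθ1 : ∀ j, θ j < 1) (hs : ∑ j, (θ j + lam j / (k : ℝ)) = 2)
    (h1 : ∀ l, θ l + lam l / (k : ℝ) < 1) (h0 : ∀ l, 0 ≤ ∑ j ∈ Finset.univ.erase l, lam j) :
    ∃ δ : ℝ, 0 < δ ∧ ∃ C : ℝ≥0, ∀ (n : ι → ℤ) (E : ι → Set (EuclideanSpace ℝ (Fin k))),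
      (∀ j, MeasurableSet (E j)) →
      (∀ j, volume (E j) ≤ ENNReal.ofReal ((2 : ℝ) ^ ((n j : ℝ) + 1))) → ∀ i,
        ∫⁻ x : EuclideanSpace ℝ (Fin k) × EuclideanSpace ℝ (Fin k),
          ∏ j, (E j).indicator (fun y => ‖y‖ₑ ^ (-lam j)) (linForm _ (v j) x) ≤
            C * ((∏ j, ENNReal.ofReal ((2 : ℝ) ^ (n j * θ j))) *
              ∏ j, ENNReal.ofReal ((2 : ℝ) ^ (-(δ * |(n j : ℝ) - n i|)))) := by
  obtain ⟨ε, hε0, hε⟩ := exists_pos_lt_of_finite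
    (fun j => min (θ j) (min (1 - θ j) (1 - (θ j + lam j / (k : ℝ)))))
    (fun j => lt_min (hθ0 j) (lt_min (by linarith [hθ1 j]) (by linarith [h1 j])))
  simp only [lt_min_iff] at hε
  -- Moves ε from θ b to θ a. The sum is unchanged, the strict conditions survive by the choice of
  -- ε, and `h0` does not involve θ; the bound gains the factor 2 ^ (ε * (n a - n b)).
  set η : ι → ι → ι → ℝ := fun a b j => (if j = a then ε else 0) - if j = b then ε else 0 with hη
  have hη1 : ∀ a b j, η a b j ≤ ε := fun a b j => by
    simp only [hη]; split_ifs <;> linarith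
  have hη2 : ∀ a b j, -ε ≤ η a b j := fun a b j => by
    simp only [hη]; split_ifs <;> linarith
  have hηs : ∀ a b (w : ι → ℝ), ∑ j, w j * η a b j = ε * (w a - w b) := fun a b w => by
    simp [hη, mul_sub, Finset.sum_sub_distrib, mul_comm]
  have hex := fun a b => exists_lintegral_prod_indicator_le hk v hv (fun j => θ j + η a b j) lam
    (fun j => by linarith [(hε j).1, hη2 a b j]) (fun j => by linarith [(hε j).2.1, hη1 a b j])
    (by
      have h2 := hηs a b fun _ => 1
      simp only [one_mul, sub_self, mul_zero] at h2
      rw [← hs, ← add_zero (∑ j, (θ j + lam j / (k : ℝ))), ← h2, ← Finset.sum_add_distrib]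
      exact Finset.sum_congr rfl fun j _ => by ring)
    (fun j => by linarith [(hε j).2.2, hη1 a b j]) h0
  choose C hC using hex
  have hcard : 0 < (Fintype.card ι : ℝ) ∨ IsEmpty ι := by
    rcases isEmpty_or_nonempty ι with h | h
    · exact Or.inr h
    · exact Or.inl (by exact_mod_cast Fintype.card_pos)
  rcases hcard with hcard | hemp
  swap
  · simp at hs
  -- The factor 2 ^ ∑ θ j pays for measures 2 ^ (n j + 1) instead of 2 ^ n j. Dividing ε by the
  -- number of indices lets the decay in the largest gap control the product of the decays in all
  -- gaps.
  refine ⟨ε / Fintype.card ι, by positivity,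
    Real.toNNReal ((2 : ℝ) ^ ∑ j, θ j) * ∑ a, ∑ b, C a b, fun n E hE hvol i => ?_⟩
  have key : ∀ a b, (-∑ j, ε / Fintype.card ι * |(n j : ℝ) - n i|) ≥ ε * ((n a : ℝ) - n b) →
      ∫⁻ x : EuclideanSpace ℝ (Fin k) × EuclideanSpace ℝ (Fin k),
          ∏ j, (E j).indicator (fun y => ‖y‖ₑ ^ (-lam j)) (linForm _ (v j) x) ≤
      C a b * ENNReal.ofReal ((2 : ℝ) ^ ((∑ j, θ j) + ∑ j, n j * θ j +
        ∑ j, -(ε / Fintype.card ι * |(n j : ℝ) - n i|))) := by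
    intro a b hab
    refine (hC a b (fun j => (2 : ℝ) ^ ((n j : ℝ) + 1)) E (fun j => by positivity) hE hvol).trans ?_
    gcongr
    rw [← ENNReal.ofReal_prod_of_nonneg fun j _ => by positivity]
    refine ENNReal.ofReal_le_ofReal ?_
    simp only [← Real.rpow_mul zero_le_two]
    rw [← Real.rpow_sum_of_pos two_pos]
    refine Real.rpow_le_rpow_of_exponent_le one_le_two ?_
    have h2 := hηs a b fun j => (n j : ℝ) + 1
    have h3 : ∑ j, ((n j : ℝ) + 1) * (θ j + η a b j) =
        ∑ j, θ j + ∑ j, n j * θ j + ∑ j, ((n j : ℝ) + 1) * η a b j := by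
      rw [← Finset.sum_add_distrib, ← Finset.sum_add_distrib]
      exact Finset.sum_congr rfl fun j _ => by ring
    rw [h3, h2, Finset.sum_neg_distrib]
    linarith
  obtain ⟨m, -, hm⟩ := Finset.exists_max_image Finset.univ (fun j => |(n j : ℝ) - n i|)
    ⟨i, Finset.mem_univ i⟩
  have hsum : ∑ j, ε / Fintype.card ι * |(n j : ℝ) - n i| ≤ ε * |(n m : ℝ) - n i| := by
    calc ∑ j, ε / Fintype.card ι * |(n j : ℝ) - n i|
        ≤ ∑ _j : ι, ε / Fintype.card ι * |(n m : ℝ) - n i| := by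
          exact Finset.sum_le_sum fun j hj => mul_le_mul_of_nonneg_left (hm j hj) (by positivity)
      _ = ε * |(n m : ℝ) - n i| := by
          rw [Finset.sum_const, Finset.card_univ, nsmul_eq_mul]
          field_simp
  -- The pair consists of i and the index m farthest from it, ordered so that n a ≤ n b.
  obtain ⟨a, b, hab⟩ : ∃ a b, (-∑ j, ε / Fintype.card ι * |(n j : ℝ) - n i|) ≥
      ε * ((n a : ℝ) - n b) := by
    rcases le_total ((n m : ℝ) - n i) 0 with h | h
    · refine ⟨m, i, ?_⟩
      rw [abs_of_nonpos h] at hsum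
      linarith
    · refine ⟨i, m, ?_⟩
      rw [abs_of_nonneg h] at hsum
      linarith
  refine (key a b hab).trans ?_
  rw [Real.rpow_add two_pos, Real.rpow_add two_pos, Real.rpow_sum_of_pos two_pos (fun j => n j * θ j),
    Real.rpow_sum_of_pos two_pos (fun j => -(ε / Fintype.card ι * |(n j : ℝ) - n i|)),
    ENNReal.ofReal_mul (mul_nonneg (by positivity) (Finset.prod_nonneg fun j _ => by positivity)),
    ENNReal.ofReal_mul (by positivity), ENNReal.ofReal_prod_of_nonneg fun j _ => by positivity,
    ENNReal.ofReal_prod_of_nonneg fun j _ => by positivity, mul_assoc, ← mul_assoc (C a b : ℝ≥0∞),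
    mul_comm (C a b : ℝ≥0∞), ENNReal.coe_mul]
  gcongr
  · rfl
  · exact (Finset.single_le_sum (f := fun b => C a b) (fun _ _ => zero_le)
      (Finset.mem_univ b)).trans (Finset.single_le_sum (f := fun a => ∑ b, C a b)
        (fun _ _ => zero_le) (Finset.mem_univ a))

/-! ### Dyadic decomposition of functions in Lorentz spaces -/

section
variable {α : Type*} [MeasurableSpace α] {μ : Measure α} {h : α → ℝ≥0∞}

theorem decRearrangement_anti {s t : ℝ} (hst : s ≤ t) :
    decRearrangement μ h t ≤ decRearrangement μ h s :=
  sInf_le_sInf fun _ hσ => le_trans hσ (ENNReal.ofReal_le_ofReal hst)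

/-- The infimum is attained: levels decreasing strictly to it exhaust the set from below, and
continuity along increasing unions needs no measurability. -/
theorem measure_decRearrangement_lt_le (t : ℝ) :
    μ {x | decRearrangement μ h t < h x} ≤ ENNReal.ofReal t := by
  set D := decRearrangement μ h t with hD
  rcases eq_or_ne D ∞ with hT | hT
  · simp [hT]
  obtain ⟨u, hanti, hgt, hlim⟩ := exists_seq_strictAnti_tendsto' (lt_top_iff_ne_top.2 hT)
  have hU : {x | D < h x} = ⋃ m, {x | u m < h x} := by
    ext x
    simp only [Set.mem_ofPred_eq, Set.mem_iUnion]
    refine ⟨fun hx => ?_, fun ⟨m, hm⟩ => (hgt m).1.trans hm⟩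
    exact (hlim.eventually (eventually_lt_nhds hx)).exists
  have hmono : Monotone fun m => {x | u m < h x} := fun a b hab x hx =>
    lt_of_le_of_lt (hanti.antitone hab) hx
  rw [hU, hmono.measure_iUnion]
  refine iSup_le fun m => ?_
  obtain ⟨σ, hσ, hσm⟩ := sInf_lt_iff.1 (hgt m).1
  exact (measure_mono fun x hx => lt_trans hσm hx).trans hσ

/-- On (2^n, 2^(n+1)] the integrand is bounded below through 2 ^ (n θ), D(2^(n+1)) and 1/t ≥
2^(-(n+1)). Shifting the index costs 2 ^ θ and the mass 1/2 costs 2 ≤ 2 ^ ρ, so the constant enters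
as a ρ-th power. -/
theorem tsum_rpow_decRearrangement_le {θ ρ : ℝ} (hθ : 0 < θ) (hρ : 1 ≤ ρ) :
    ∑' n : ℤ, (ENNReal.ofReal ((2 : ℝ) ^ (n * θ)) *
        decRearrangement μ h ((2 : ℝ) ^ (n : ℝ))) ^ ρ ≤
      (ENNReal.ofReal (2 * 2 ^ θ)) ^ ρ *
      ∫⁻ t in Set.Ioi (0 : ℝ), (ENNReal.ofReal (t ^ θ) * decRearrangement μ h t) ^ ρ
        * ENNReal.ofReal (1 / t) := by
  have hρ0 : 0 ≤ ρ := by linarith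
  set D := decRearrangement μ h with hD
  set g : ℝ → ℝ≥0∞ := fun t => (ENNReal.ofReal (t ^ θ) * D t) ^ ρ * ENNReal.ofReal (1 / t) with hg
  have hpos : ∀ n : ℤ, (0 : ℝ) < 2 ^ (n : ℝ) := fun n => by positivity
  have hmono : Monotone fun n : ℤ => (2 : ℝ) ^ (n : ℝ) := fun m n hmn =>
    Real.rpow_le_rpow_of_exponent_le one_le_two (by exact_mod_cast hmn)
  have hpiece : ∀ n : ℤ, (ENNReal.ofReal ((2 : ℝ) ^ (((n + 1 : ℤ) : ℝ) * θ)) *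
      D ((2 : ℝ) ^ ((n + 1 : ℤ) : ℝ))) ^ ρ ≤ ENNReal.ofReal (2 * 2 ^ θ) ^ ρ *
        ∫⁻ t in Set.Ioc ((2 : ℝ) ^ (n : ℝ)) (2 ^ ((Order.succ n : ℤ) : ℝ)), g t := by
    intro n
    rw [Order.succ_eq_add_one]
    have h2n : (2 : ℝ) ^ ((n + 1 : ℤ) : ℝ) = 2 ^ (n : ℝ) * 2 := by
      push_cast
      rw [Real.rpow_add two_pos, Real.rpow_one]
    set w := ENNReal.ofReal ((2 : ℝ) ^ (n * θ)) * D ((2 : ℝ) ^ ((n + 1 : ℤ) : ℝ)) with hw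
    have hlow : w ^ ρ * ENNReal.ofReal (1 / 2) ≤
        ∫⁻ t in Set.Ioc ((2 : ℝ) ^ (n : ℝ)) (2 ^ ((n + 1 : ℤ) : ℝ)), g t := by
      calc w ^ ρ * ENNReal.ofReal (1 / 2)
          = ∫⁻ _t in Set.Ioc ((2 : ℝ) ^ (n : ℝ)) (2 ^ ((n + 1 : ℤ) : ℝ)),
              w ^ ρ * ENNReal.ofReal (1 / 2 ^ ((n + 1 : ℤ) : ℝ)) := by
            rw [setLIntegral_const, Real.volume_Ioc, mul_assoc, ← ENNReal.ofReal_mul (by positivity),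
              h2n]
            congr 2
            have := hpos n
            field_simp
            ring
        _ ≤ _ := by
            refine setLIntegral_mono' measurableSet_Ioc fun t ht => ?_
            have ht0 : 0 < t := (hpos n).trans ht.1
            simp only [hg, hw]
            gcongr ?_ ^ ρ * ENNReal.ofReal ?_
            · gcongr ENNReal.ofReal ?_ * ?_
              · rw [Real.rpow_mul zero_le_two]
                exact Real.rpow_le_rpow (hpos n).le ht.1.le hθ.le
              · exact decRearrangement_anti ht.2
            · exact one_div_le_one_div_of_le ht0 ht.2
    have hup : ENNReal.ofReal ((2 : ℝ) ^ (((n + 1 : ℤ) : ℝ) * θ)) *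
        D ((2 : ℝ) ^ ((n + 1 : ℤ) : ℝ)) = ENNReal.ofReal (2 ^ θ) * w := by
      rw [hw, ← mul_assoc, ← ENNReal.ofReal_mul (by positivity), ← Real.rpow_add two_pos]
      congr 3
      push_cast
      ring
    calc _ = ENNReal.ofReal (2 ^ θ) ^ ρ * w ^ ρ := by
          rw [hup, ENNReal.mul_rpow_of_nonneg _ _ hρ0]
      _ = ENNReal.ofReal (2 ^ θ) ^ ρ * (ENNReal.ofReal 2 * (w ^ ρ * ENNReal.ofReal (1 / 2))) := by
          rw [mul_left_comm (ENNReal.ofReal 2), ← ENNReal.ofReal_mul zero_le_two]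
          norm_num
      _ ≤ ENNReal.ofReal (2 ^ θ) ^ ρ * (ENNReal.ofReal 2 ^ ρ *
          ∫⁻ t in Set.Ioc ((2 : ℝ) ^ (n : ℝ)) (2 ^ ((n + 1 : ℤ) : ℝ)), g t) := by
          gcongr
          calc ENNReal.ofReal 2 = ENNReal.ofReal 2 ^ (1 : ℝ) := (ENNReal.rpow_one _).symm
            _ ≤ _ := ENNReal.rpow_le_rpow_of_exponent_le (by simp) hρ
      _ = _ := by
          rw [ENNReal.ofReal_mul zero_le_two, ENNReal.mul_rpow_of_nonneg _ _ hρ0]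
          ring
  calc _ = ∑' n : ℤ, (ENNReal.ofReal ((2 : ℝ) ^ (((n + 1 : ℤ) : ℝ) * θ)) *
        D ((2 : ℝ) ^ ((n + 1 : ℤ) : ℝ))) ^ ρ :=
        ((Equiv.addRight (1 : ℤ)).tsum_eq fun n : ℤ => (ENNReal.ofReal ((2 : ℝ) ^ (n * θ)) *
          D ((2 : ℝ) ^ (n : ℝ))) ^ ρ).symm
    _ ≤ ∑' n : ℤ, ENNReal.ofReal (2 * 2 ^ θ) ^ ρ *
        ∫⁻ t in Set.Ioc ((2 : ℝ) ^ (n : ℝ)) (2 ^ ((Order.succ n : ℤ) : ℝ)), g t :=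
        ENNReal.tsum_le_tsum hpiece
    _ = ENNReal.ofReal (2 * 2 ^ θ) ^ ρ *
        ∫⁻ t in ⋃ n : ℤ, Set.Ioc ((2 : ℝ) ^ (n : ℝ)) (2 ^ ((Order.succ n : ℤ) : ℝ)), g t := by
        rw [ENNReal.tsum_mul_left, lintegral_iUnion (fun _ => measurableSet_Ioc)
          hmono.pairwise_disjoint_on_Ioc_succ]
    _ ≤ _ := by
        gcongr
        exact Set.iUnion_subset fun n t ht => (hpos n).trans ht.1

theorem lorentzNorm_dyadic_tsum_le {p : ℝ} {r : ℝ≥0∞} (hp : 0 < 1 / p) (hr : 1 ≤ r) (hr' : r ≠ ∞) :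
    ∑' n : ℤ, (ENNReal.ofReal ((2 : ℝ) ^ (n * (1 / p))) *
        decRearrangement μ h ((2 : ℝ) ^ (n : ℝ))) ^ r.toReal ≤
      (ENNReal.ofReal (2 * 2 ^ (1 / p)) * lorentzNorm μ p r h) ^ r.toReal := by
  have hρ : 1 ≤ r.toReal := by
    simpa using ENNReal.toReal_mono hr' hr
  refine (tsum_rpow_decRearrangement_le hp hρ).trans_eq ?_
  rw [ENNReal.mul_rpow_of_nonneg _ _ (by linarith), lorentzNorm, if_neg hr', ← ENNReal.rpow_mul,
    one_div_mul_cancel (by linarith), ENNReal.rpow_one]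

theorem lorentzNorm_dyadic_le {p : ℝ} {r : ℝ≥0∞} (hp : 0 < 1 / p) (hr : 1 ≤ r) (n : ℤ) :
    ENNReal.ofReal ((2 : ℝ) ^ (n * (1 / p))) * decRearrangement μ h ((2 : ℝ) ^ (n : ℝ)) ≤
      ENNReal.ofReal (2 * 2 ^ (1 / p)) * lorentzNorm μ p r h := by
  by_cases hr' : r = ∞
  · have h1 : (1 : ℝ) ≤ 2 ^ (1 / p) := Real.one_le_rpow one_le_two hp.le
    have h2 : ENNReal.ofReal ((2 : ℝ) ^ (n * (1 / p))) * decRearrangement μ h ((2 : ℝ) ^ (n : ℝ)) ≤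
        lorentzNorm μ p r h := by
      rw [lorentzNorm, if_pos hr', Real.rpow_mul zero_le_two]
      exact le_iSup₂ (f := fun (t : ℝ) (_ : t ∈ Set.Ioi (0 : ℝ)) =>
        ENNReal.ofReal (t ^ (1 / p)) * decRearrangement μ h t) ((2 : ℝ) ^ (n : ℝ))
        (Set.mem_Ioi.2 (by positivity))
    refine h2.trans (le_mul_of_one_le_left zero_le ?_)
    rw [ENNReal.one_le_ofReal]
    linarith
  · have hρ : 0 < r.toReal := ENNReal.toReal_pos (one_pos.trans_le hr).ne' hr'
    rw [← ENNReal.rpow_le_rpow_iff hρ]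
    exact (ENNReal.le_tsum n).trans (lorentzNorm_dyadic_tsum_le hp hr hr')

/-- A single term suffices: for the largest n with h x ≤ D n one has D (n + 1) < h x, so the n-th
indicator is 1 at x. Such an n exists because almost every x lies below some D n, while finiteness
of the norm forces D n below h x for large n when h x ≠ 0. -/
theorem ae_le_tsum_indicator {p : ℝ} {r : ℝ≥0∞} (hp : 0 < 1 / p) (hr : 1 ≤ r)
    (hfin : lorentzNorm μ p r h ≠ ∞) :
    ∀ᵐ x ∂μ, h x ≤ ∑' n : ℤ, {x | decRearrangement μ h ((2 : ℝ) ^ ((n : ℝ) + 1)) < h x}.indicator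
      (fun _ => decRearrangement μ h ((2 : ℝ) ^ (n : ℝ))) x := by
  set D : ℤ → ℝ≥0∞ := fun n => decRearrangement μ h ((2 : ℝ) ^ (n : ℝ)) with hD
  have hbdd : ∀ᵐ x ∂μ, ∃ n, h x ≤ D n := by
    rw [ae_iff]
    have h1 : ∀ m : ℕ, μ {x | ¬ ∃ n, h x ≤ D n} ≤ ENNReal.ofReal ((1 / 2) ^ m) := fun m => by
      refine (measure_mono fun x hx => ?_).trans
        ((measure_decRearrangement_lt_le (h := h) ((2 : ℝ) ^ (((-m : ℤ) : ℝ)))).trans_eq ?_)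
      · simp only [Set.mem_ofPred_eq, not_exists, not_le] at hx
        exact hx (-m)
      · rw [Real.rpow_intCast]
        simp
    have h2 : Filter.Tendsto (fun m : ℕ => ENNReal.ofReal ((1 / 2) ^ m)) Filter.atTop (nhds 0) := by
      rw [← ENNReal.ofReal_zero]
      exact ENNReal.tendsto_ofReal
        (tendsto_pow_atTop_nhds_zero_of_lt_one (by norm_num) (by norm_num))
    exact le_antisymm (ge_of_tendsto' h2 h1) zero_le
  filter_upwards [hbdd] with x hx
  rcases eq_or_ne (h x) 0 with hx0 | hx0
  · rw [hx0]; exact zero_le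
  have hB : ENNReal.ofReal (2 * 2 ^ (1 / p)) * lorentzNorm μ p r h ≠ ∞ :=
    ENNReal.mul_ne_top ENNReal.ofReal_ne_top hfin
  set B := ENNReal.ofReal (2 * 2 ^ (1 / p)) * lorentzNorm μ p r h
  obtain ⟨b, hb⟩ : ∃ b : ℤ, D b < h x := by
    by_contra! hall
    obtain ⟨m, hm⟩ := pow_unbounded_of_one_lt (B / h x).toReal
      (Real.one_lt_rpow one_lt_two hp)
    have h1 : ENNReal.ofReal ((2 : ℝ) ^ (((m : ℤ) : ℝ) * (1 / p))) ≤ B / h x :=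
      (ENNReal.le_div_iff_mul_le (Or.inl hx0) (Or.inr hB)).2
        ((mul_le_mul_right (hall m) _).trans (lorentzNorm_dyadic_le hp hr m))
    have h2 := ENNReal.toReal_mono (ENNReal.div_ne_top hB hx0) h1
    rw [ENNReal.toReal_ofReal (by positivity)] at h2
    refine absurd hm (not_lt.2 (le_trans (le_of_eq ?_) h2))
    rw [← Real.rpow_natCast, ← Real.rpow_mul zero_le_two, mul_comm]
    simp
  have hanti : ∀ m n : ℤ, m ≤ n → D n ≤ D m := fun m n hmn =>
    decRearrangement_anti (Real.rpow_le_rpow_of_exponent_le one_le_two (by exact_mod_cast hmn))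
  obtain ⟨n, hn, hmax⟩ := Int.exists_greatest_of_bdd (P := fun n => h x ≤ D n)
    ⟨b, fun z hz => by
      by_contra! hzb
      exact absurd (hz.trans (hanti b z hzb.le)) (not_le.2 hb)⟩ hx
  have hlt : D (n + 1) < h x := by
    by_contra! hle
    have := hmax (n + 1) hle
    omega
  refine le_trans ?_ (ENNReal.le_tsum n)
  rw [Set.indicator_of_mem]
  · exact hn
  · simpa only [Set.mem_ofPred_eq, hD, Int.cast_add, Int.cast_one] using hlt

theorem ae_eq_zero_of_lorentzNorm_eq_zero {p : ℝ} {r : ℝ≥0∞} (hp : 0 < 1 / p) (hr : 1 ≤ r)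
    (h0 : lorentzNorm μ p r h = 0) : ∀ᵐ x ∂μ, h x = 0 := by
  have hD : ∀ n : ℤ, decRearrangement μ h ((2 : ℝ) ^ (n : ℝ)) = 0 := fun n => by
    have h1 := lorentzNorm_dyadic_le (μ := μ) (h := h) hp hr n
    rw [h0, mul_zero, nonpos_iff_eq_zero, mul_eq_zero] at h1
    exact h1.resolve_left (ENNReal.ofReal_pos.2 (by positivity)).ne'
  filter_upwards [ae_le_tsum_indicator (μ := μ) (h := h) hp hr (by simp [h0])] with x hx
  simpa only [hD, Set.indicator_zero, tsum_zero, nonpos_iff_eq_zero] using hx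

end

/-! ### Summation over dyadic scales -/

theorem tsum_two_rpow_neg_abs_ne_top {δ : ℝ} (hδ : 0 < δ) :
    ∑' q : ℤ, ENNReal.ofReal ((2 : ℝ) ^ (-(δ * |(q : ℝ)|))) ≠ ∞ := by
  have hgeo : Summable fun n : ℕ => ((2 : ℝ) ^ (-δ)) ^ n :=
    summable_geometric_of_lt_one (by positivity)
      (Real.rpow_lt_one_of_one_lt_of_neg one_lt_two (by linarith))
  have hterm : ∀ n : ℕ, (2 : ℝ) ^ (-(δ * |(n : ℝ)|)) = ((2 : ℝ) ^ (-δ)) ^ n := fun n => by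
    rw [Nat.abs_cast, ← neg_mul, Real.rpow_mul zero_le_two, Real.rpow_natCast]
  have hsum : Summable fun q : ℤ => (2 : ℝ) ^ (-(δ * |(q : ℝ)|)) := by
    have h1 : Summable fun n : ℕ => (2 : ℝ) ^ (-(δ * |(n : ℝ)|)) := by
      simpa only [hterm] using hgeo
    exact Summable.of_nat_of_neg (by simpa only [Int.cast_natCast] using h1)
      (by simpa only [Int.cast_neg, Int.cast_natCast, abs_neg] using h1)
  exact hsum.tsum_ofReal_ne_top

/-- After normalising by B j, `prod_le_sum_rpow` replaces the product of coefficients by a sum of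
terms each depending on one n i only. That term is summable in n i, and the decay around n i sums
the other indices. -/
theorem exists_tsum_prod_le {N : ℕ} [NeZero N] (r : Fin N → ℝ≥0∞) (hr : ∀ j, 1 ≤ r j)
    (hinterp : 1 ≤ ∑ j, (r j)⁻¹) {δ : ℝ} (hδ : 0 < δ) :
    ∃ C : ℝ≥0, ∀ (a : Fin N → ℤ → ℝ≥0∞) (B : Fin N → ℝ≥0∞) (c : ℝ≥0∞) (T : (Fin N → ℤ) → ℝ≥0∞),
      (∀ j, B j ≠ ∞) → (∀ j n, a j n ≤ B j) →
      (∀ j, r j ≠ ∞ → ∑' n, a j n ^ (r j).toReal ≤ B j ^ (r j).toReal) →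
      (∀ n i, T n ≤ c * ((∏ j, a j (n j)) *
        ∏ j, ENNReal.ofReal ((2 : ℝ) ^ (-(δ * |(n j : ℝ) - n i|))))) →
      ∑' n, T n ≤ c * (C * ∏ j, B j) := by
  have hW := tsum_two_rpow_neg_abs_ne_top hδ
  set W := ∑' q : ℤ, ENNReal.ofReal ((2 : ℝ) ^ (-(δ * |(q : ℝ)|))) with hWdef
  refine ⟨∑ _i : Fin N, W.toNNReal ^ N, fun a B c T hB ha hsum hT => ?_⟩
  by_cases hB0 : ∃ j, B j = 0
  · obtain ⟨j, hj⟩ := hB0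
    have hT0 : ∀ n, T n = 0 := fun n => by
      have h1 := hT n j
      rw [Finset.prod_eq_zero (Finset.mem_univ j) (le_antisymm ((ha j (n j)).trans_eq hj) zero_le),
        zero_mul, mul_zero] at h1
      exact le_antisymm h1 zero_le
    simp [hT0]
  push Not at hB0
  set u : Fin N → ℤ → ℝ≥0∞ := fun j n =>
    if r j = ∞ then 0 else (a j n / B j) ^ (r j).toReal with hu
  have husum : ∀ j, ∑' n, u j n ≤ 1 := by
    intro j
    by_cases hj : r j = ∞
    · simp [hu, hj]
    · simp only [hu, if_neg hj]
      simp only [ENNReal.div_rpow_of_nonneg _ _ ENNReal.toReal_nonneg]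
      simp only [div_eq_mul_inv]
      rw [ENNReal.tsum_mul_right, ← div_eq_mul_inv]
      exact ENNReal.div_le_of_le_mul ((hsum j hj).trans_eq (one_mul _).symm)
  set w : (Fin N → ℤ) → Fin N → ℝ≥0∞ := fun n i =>
    ∏ j, ENNReal.ofReal ((2 : ℝ) ^ (-(δ * |(n j : ℝ) - n i|))) with hw
  have hterm : ∀ n, T n ≤ c * ((∏ j, B j) * ∑ i, u i (n i) * w n i) := by
    intro n
    -- The hypothesis holds for every centre; taking the smallest weight makes it usable with
    -- whichever i appears in the sum.
    obtain ⟨m, -, hm⟩ := Finset.exists_min_image Finset.univ (w n) ⟨0, Finset.mem_univ _⟩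
    refine (hT n m).trans ?_
    gcongr c * ?_
    have h1 : ∏ j, a j (n j) = (∏ j, B j) * ∏ j, a j (n j) / B j := by
      rw [← Finset.prod_mul_distrib]
      exact Finset.prod_congr rfl fun j _ => (ENNReal.mul_div_cancel (hB0 j) (hB j)).symm
    rw [h1, mul_assoc]
    gcongr (∏ j, B j) * ?_
    calc (∏ j, a j (n j) / B j) * w n m ≤ (∑ i, u i (n i)) * w n m := by
          gcongr
          exact prod_le_sum_rpow _ r (fun j => ENNReal.div_le_of_le_mul (by simpa using ha j (n j)))
            hr hinterp
      _ ≤ _ := by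
          rw [Finset.sum_mul]
          gcongr with i
          exact hm i (Finset.mem_univ i)
  have hshift : ∀ m : ℤ, ∑' q : ℤ, ENNReal.ofReal ((2 : ℝ) ^ (-(δ * |(q : ℝ) - m|))) = W := by
    intro m
    rw [hWdef, ← (Equiv.subRight m).tsum_eq
      fun q : ℤ => ENNReal.ofReal ((2 : ℝ) ^ (-(δ * |(q : ℝ)|)))]
    simp
  have hsum1 : ∀ i, ∑' n : Fin N → ℤ, u i (n i) * w n i ≤ W ^ N := by
    intro i
    -- The centre n i is freed into an independent variable m, so that the sum over n factorises
    -- into N equal series.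
    calc ∑' n : Fin N → ℤ, u i (n i) * w n i
        ≤ ∑' n : Fin N → ℤ, ∑' m : ℤ, u i m *
            ∏ j, ENNReal.ofReal ((2 : ℝ) ^ (-(δ * |(n j : ℝ) - m|))) :=
          ENNReal.tsum_le_tsum fun n => ENNReal.le_tsum (f := fun m : ℤ => u i m *
            ∏ j, ENNReal.ofReal ((2 : ℝ) ^ (-(δ * |(n j : ℝ) - m|)))) (n i)
      _ = ∑' m : ℤ, u i m * W ^ N := by
          rw [ENNReal.tsum_comm]
          refine tsum_congr fun m => ?_
          rw [ENNReal.tsum_mul_left, ← ENNReal.prod_tsum_eq_tsum_prod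
            (fun (_ : Fin N) (q : ℤ) => ENNReal.ofReal ((2 : ℝ) ^ (-(δ * |(q : ℝ) - m|)))), hshift]
          simp
      _ ≤ W ^ N := by
          rw [ENNReal.tsum_mul_right]
          exact mul_le_of_le_one_left zero_le (husum i)
  calc ∑' n, T n ≤ ∑' n, c * ((∏ j, B j) * ∑ i, u i (n i) * w n i) := ENNReal.tsum_le_tsum hterm
    _ = c * ((∏ j, B j) * ∑ i, ∑' n : Fin N → ℤ, u i (n i) * w n i) := by
        rw [ENNReal.tsum_mul_left, ENNReal.tsum_mul_left,
          Summable.tsum_finsetSum fun _ _ => ENNReal.summable]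
    _ ≤ c * ((∏ j, B j) * ∑ _i : Fin N, W ^ N) := by
        gcongr with i
        exact hsum1 i
    _ = _ := by
        push_cast
        rw [ENNReal.coe_toNNReal hW, mul_comm (∏ j, B j)]

theorem theorem2p5 (k N : ℕ) (hk : 0 < k)
    (v : Fin N → Fin 2 → ℝ)
    (hv0 : ∀ j, v j ≠ 0)
    (hv : ∀ i j, i ≠ j → LinearIndependent ℝ ![v i, v j])
    (p lam : Fin N → ℝ) (r : Fin N → ℝ≥0∞)
    (hp : ∀ j, 1 / p j ∈ Set.Ioo (0 : ℝ) 1)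
    (hscaling : ∑ j, (1 / p j + lam j / (k : ℝ)) = 2)
    (hhyper : ∀ l, 1 < ∑ j ∈ Finset.univ.erase l, (1 / p j + lam j / (k : ℝ)))
    (hindex : ∀ l, 0 ≤ ∑ j ∈ Finset.univ.erase l, lam j)
    (hr : ∀ j, 1 ≤ r j)
    (hinterp : 1 ≤ ∑ j, (r j)⁻¹) :
    ∃ C : ℝ≥0, ∀ f : Fin N → EuclideanSpace ℝ (Fin k) → ℝ≥0∞,
      (∀ j, AEMeasurable (f j) volume) →
        multilinForm v f ≤ C * ∏ j, weightedLorentzNorm (p j) (r j) (lam j) (f j) := by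
  have h1 : ∀ l, 1 / p l + lam l / (k : ℝ) < 1 := fun l => by
    have := Finset.add_sum_erase Finset.univ (fun j => 1 / p j + lam j / (k : ℝ))
      (Finset.mem_univ l)
    rw [hscaling] at this
    linarith [hhyper l]
  have : NeZero N := ⟨by rintro rfl; simp at hscaling⟩
  have : Nontrivial (EuclideanSpace ℝ (Fin k)) :=
    Module.nontrivial_of_finrank_pos (R := ℝ) (by rw [finrank_euclideanSpace_fin]; exact hk)
  obtain ⟨δ, hδ, C₁, hC₁⟩ := exists_lintegral_prod_indicator_le_decay hk v hv (fun j => 1 / p j) lam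
    (fun j => (hp j).1) (fun j => (hp j).2) hscaling h1 hindex
  obtain ⟨C₂, hC₂⟩ := exists_tsum_prod_le r hr hinterp hδ
  set c : Fin N → ℝ := fun j => 2 * 2 ^ (1 / p j) with hc
  -- The `+ 1` keeps the constant nonzero, so that the right-hand side is ∞ when some norm is
  -- infinite and none vanishes.
  refine ⟨C₁ * (C₂ * ∏ j, Real.toNNReal (c j)) + 1, fun f _ => ?_⟩
  set h : Fin N → EuclideanSpace ℝ (Fin k) → ℝ≥0∞ := fun j y => ‖y‖ₑ ^ lam j * f j y with hh
  set A : Fin N → ℝ≥0∞ := fun j => lorentzNorm volume (p j) (r j) (h j) with hA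
  change ∫⁻ x : EuclideanSpace ℝ (Fin k) × EuclideanSpace ℝ (Fin k),
    ∏ j, f j (linForm _ (v j) x) ≤ _ * ∏ j, A j
  have hpull : ∀ {P : Fin N → EuclideanSpace ℝ (Fin k) → Prop}, (∀ j, ∀ᵐ y, P j y) →
      ∀ᵐ x : EuclideanSpace ℝ (Fin k) × EuclideanSpace ℝ (Fin k),
        ∀ j, P j (linForm _ (v j) x) := fun {P} hP => by
    refine ae_all_iff.2 fun j => ?_
    obtain ⟨b, hb⟩ := exists_ne_of_sum_eq_two _ hscaling h1 j
    exact ae_linForm (hv j b hb) (hP j)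
  have hf : ∀ j (y : EuclideanSpace ℝ (Fin k)), y ≠ 0 → f j y = ‖y‖ₑ ^ (-lam j) * h j y := by
    intro j y hy
    rw [hh, ← mul_assoc, ← ENNReal.rpow_add _ _ (enorm_ne_zero.2 hy) enorm_ne_top,
      neg_add_cancel, ENNReal.rpow_zero, one_mul]
  have hne0 : ∀ᵐ x : EuclideanSpace ℝ (Fin k) × EuclideanSpace ℝ (Fin k),
      ∀ j, linForm _ (v j) x ≠ 0 :=
    hpull fun _ => compl_mem_ae_iff.2 (measure_singleton (0 : EuclideanSpace ℝ (Fin k)))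
  by_cases hA0 : ∃ i, A i = 0
  · obtain ⟨i, hi⟩ := hA0
    have hzero : ∀ᵐ x : EuclideanSpace ℝ (Fin k) × EuclideanSpace ℝ (Fin k),
        ∀ j, j = i → h j (linForm _ (v j) x) = 0 :=
      hpull (P := fun j y => j = i → h j y = 0) fun j => by
        by_cases hj : j = i
        · subst hj
          exact (ae_eq_zero_of_lorentzNorm_eq_zero (hp j).1 (hr j) hi).mono fun y hy _ => hy
        · exact Filter.Eventually.of_forall fun y hy => absurd hy hj
    rw [lintegral_congr_ae (g := fun _ => 0) ?_, lintegral_zero]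
    · exact zero_le
    · filter_upwards [hzero, hne0] with x hx hx0
      exact Finset.prod_eq_zero (Finset.mem_univ i) (by rw [hf i _ (hx0 i), hx i rfl, mul_zero])
  push Not at hA0
  by_cases hAtop : ∃ j, A j = ∞
  · obtain ⟨j, hj⟩ := hAtop
    rw [← Finset.mul_prod_erase Finset.univ A (Finset.mem_univ j), hj,
      ENNReal.top_mul (Finset.prod_ne_zero_iff.2 fun i _ => hA0 i), ENNReal.mul_top (by simp)]
    exact le_top
  push Not at hAtop
  set D : Fin N → ℤ → ℝ≥0∞ := fun j n => decRearrangement volume (h j) ((2 : ℝ) ^ (n : ℝ)) with hD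
  -- The measurable hull has the same measure as the level set and only enlarges the dyadic
  -- majorant.
  set E : Fin N → ℤ → Set (EuclideanSpace ℝ (Fin k)) := fun j n => toMeasurable volume
    {y | decRearrangement volume (h j) ((2 : ℝ) ^ ((n : ℝ) + 1)) < h j y} with hE
  have hEm : ∀ j n, MeasurableSet (E j n) := fun j n => measurableSet_toMeasurable _ _
  have hEvol : ∀ j n, volume (E j n) ≤ ENNReal.ofReal ((2 : ℝ) ^ ((n : ℝ) + 1)) := fun j n => by
    rw [hE, measure_toMeasurable]
    exact measure_decRearrangement_lt_le _
  set g : Fin N → ℤ → EuclideanSpace ℝ (Fin k) → ℝ≥0∞ := fun j n =>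
    (E j n).indicator fun y => ‖y‖ₑ ^ (-lam j) with hg
  have hgm : ∀ j n, Measurable fun x : EuclideanSpace ℝ (Fin k) × EuclideanSpace ℝ (Fin k) =>
      g j n (linForm _ (v j) x) := fun j n =>
    (Measurable.indicator (by fun_prop) (hEm j n)).comp (measurable_linForm (v j))
  have hdec : ∀ᵐ x : EuclideanSpace ℝ (Fin k) × EuclideanSpace ℝ (Fin k), ∀ j,
      h j (linForm _ (v j) x) ≤ ∑' n : ℤ, (E j n).indicator (fun _ => D j n) (linForm _ (v j) x) :=
    hpull fun j => (ae_le_tsum_indicator (hp j).1 (hr j) (hAtop j)).mono fun y hy =>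
      hy.trans (ENNReal.tsum_le_tsum fun n =>
        Set.indicator_le_indicator_of_subset (subset_toMeasurable _ _) (fun _ => zero_le) y)
  have hgpm : ∀ n : Fin N → ℤ, Measurable
      fun x : EuclideanSpace ℝ (Fin k) × EuclideanSpace ℝ (Fin k) =>
        ∏ j, g j (n j) (linForm _ (v j) x) := fun n =>
    Finset.measurable_fun_prod _ fun j _ => hgm j (n j)
  calc ∫⁻ x : EuclideanSpace ℝ (Fin k) × EuclideanSpace ℝ (Fin k), ∏ j, f j (linForm _ (v j) x)
      ≤ ∫⁻ x : EuclideanSpace ℝ (Fin k) × EuclideanSpace ℝ (Fin k),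
          ∑' n : Fin N → ℤ, (∏ j, D j (n j)) * ∏ j, g j (n j) (linForm _ (v j) x) := by
        refine lintegral_mono_ae ?_
        filter_upwards [hne0, hdec] with x hx0 hx
        simp only [← Finset.prod_mul_distrib]
        rw [← ENNReal.prod_tsum_eq_tsum_prod fun j n => D j n * g j n (linForm _ (v j) x)]
        gcongr with j
        rw [hf j _ (hx0 j)]
        refine (mul_le_mul_right (hx j) _).trans_eq ?_
        rw [← ENNReal.tsum_mul_left]
        refine tsum_congr fun n => ?_
        by_cases hxE : linForm _ (v j) x ∈ E j n
        · simp only [hg, Set.indicator_of_mem hxE, mul_comm]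
        · simp only [hg, Set.indicator_of_notMem hxE, mul_zero]
    _ = ∑' n : Fin N → ℤ, (∏ j, D j (n j)) *
          ∫⁻ x : EuclideanSpace ℝ (Fin k) × EuclideanSpace ℝ (Fin k),
            ∏ j, g j (n j) (linForm _ (v j) x) := by
        rw [lintegral_tsum fun n => ((hgpm n).const_mul _).aemeasurable]
        exact tsum_congr fun n => lintegral_const_mul _ (hgpm n)
    _ ≤ C₁ * (C₂ * ∏ j, (ENNReal.ofReal (c j) * A j)) := by
        refine hC₂ (fun j n => ENNReal.ofReal ((2 : ℝ) ^ (n * (1 / p j))) * D j n) _ _ _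
          (fun j => ENNReal.mul_ne_top ENNReal.ofReal_ne_top (hAtop j))
          (fun j n => lorentzNorm_dyadic_le (hp j).1 (hr j) n)
          (fun j hj => lorentzNorm_dyadic_tsum_le (hp j).1 (hr j) hj) fun n i => ?_
        refine (mul_le_mul_right (hC₁ n (fun j => E j (n j)) (fun j => hEm j _)
          (fun j => hEvol j _) i) _).trans_eq ?_
        rw [Finset.prod_mul_distrib]
        ring
    _ ≤ _ := by
        rw [Finset.prod_mul_distrib]
        push_cast
        rw [add_mul, mul_assoc, mul_assoc]
        exact le_self_add
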